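/- **Setting.** Let $d\ge 2$ and let $C=[-1,1]^d$ be the choice set in every round. An instance is a vector $\beta\in[-1,1]^d$. In round $t=1,2,\dots$ an algorithm chooses (measurably) a probability distribution $\pi_t$ on $C$ depending on the past choices and rewards, draws $x_t\sim\pi_t$, and observes $y_t=\langle x_t,\beta\rangle+\eta_t$, where the noise variables $\eta_t$ are independent and uniform on $[-1,1]$. The regret after $T$ rounds is $R(T)=\sum_{t=1}^{T}\bigl(\max_{x\in C}\langle x,\beta\rangle-\langle x_t,\beta\rangle\bigr)$. The gap of $\beta$ is $\inf\langle x^\star-x,\beta\rangle$ over the extreme points $x\ne x^\star$ of $C$, where $x^\star$ is a maximizer of $\langle\cdot,\beta\rangle$ on $C$ (so the gap is $0$ if the maximizer is not unique). A discrete (resp. continuous) distribution on $C$ is fair for $\beta$ if its probability mass function (resp. some probability density function of it) $g$ satisfies $g(x)\ge g(x')$ for all $x,x'\in C$ with $\langle x,\beta\rangle\ge\langle x',\beta\rangle$. The distribution $\pi_t$ is round-fair for $\beta$ if it is a finite or countable mixture of distributions on $C$, each of them discrete or continuous and fair for $\beta$. An algorithm that takes a confidence parameter $\delta'$ as input is fair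 (over $T$ rounds) if for every input $\delta'\in(0,1]$ and every $\beta\in[-1,1]^d$, with probability at least $1-\delta'$, all of $\pi_1,\dots,\pi_T$ are round-fair for $\beta$. **Theorem.** There is an absolute constant $c>0$ such that for every $d\ge2$ and every $\Delta\in(0,2]$ there is a probability distribution $\tau$ on $[-1,1]^d$ under which almost every instance has gap at least $\Delta$, and such that the following holds for every $T\ge 1/\Delta$, every algorithm that is fair over $T$ rounds, every $\delta\in(0,1)$ and every $\delta'\in(0,\delta/8]$: if $\beta\sim\tau$ and the algorithm is then run on $\beta$ with input $\delta'$, then $$\Pr\Bigl[\,R(T)\ \ge\ \frac{c\,\delta}{\Delta}\,\Bigr]\ \ge\ 1-\delta .$$ In particular, for fixed $\delta$ the regret is $\Omega(1/\Delta)$ with probability at least $1-\delta$. -/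

import Mathlib

open MeasureTheory ProbabilityTheory Set
open scoped ENNReal

namespace FairBandit

noncomputable section

/-- The choice set `[-1,1]^d`, available in every round. -/
def choiceSet (d : ℕ) : Set (Fin d → ℝ) := Set.Icc (fun _ => -1) (fun _ => 1)

/-- A history of `t` rounds: the chosen points with the rewards observed for them. -/
abbrev History (d t : ℕ) : Type := Fin t → (Fin d → ℝ) × ℝ

/-- A (randomised) bandit algorithm that picks one point of `[-1,1]^d` per round: for every number
`t` of rounds played so far, a probability distribution over `[-1,1]^d` that depends (measurably)
on the choices and rewards of these `t` rounds. -/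
structure Algorithm (d : ℕ) where
  policy : (t : ℕ) → Kernel (History d t) (Fin d → ℝ)
  isMarkov : ∀ t, IsMarkovKernel (policy t)
  support : ∀ t h, policy t h (choiceSet d)ᶜ = 0

instance {d : ℕ} (A : Algorithm d) (t : ℕ) : IsMarkovKernel (A.policy t) := A.isMarkov t

/-- The uniform distribution on `[-1,1]`. -/
def noise : Measure ℝ := ProbabilityTheory.cond volume (Set.Icc (-1) 1)

instance : IsProbabilityMeasure noise :=
  ProbabilityTheory.cond_isProbabilityMeasure_of_finite
    (by simp [Real.volume_Icc]) (by simp [Real.volume_Icc])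

/-- Given `(β, x)`, the law of the reward `⟨x, β⟩ + η` with `η` uniform on `[-1,1]`. -/
def rewardKernel (d : ℕ) : Kernel ((Fin d → ℝ) × (Fin d → ℝ)) ℝ :=
  (Kernel.deterministic (fun p : (Fin d → ℝ) × (Fin d → ℝ) => p.2 ⬝ᵥ p.1)
      (by simp only [dotProduct]; fun_prop) ×ₖ Kernel.const _ noise).map
    (fun q : ℝ × ℝ => q.1 + q.2)

instance (d : ℕ) : IsMarkovKernel (rewardKernel d) := by
  unfold rewardKernel
  exact Kernel.IsMarkovKernel.map _ (by fun_prop)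

/-- Given `(β, h)`, with `h` the history of the first `t` rounds, the law of the next pair
(choice, reward). -/
def Algorithm.stepKernel {d : ℕ} (A : Algorithm d) (t : ℕ) :
    Kernel ((Fin d → ℝ) × History d t) ((Fin d → ℝ) × ℝ) :=
  (A.policy t).comap Prod.snd measurable_snd ⊗ₖ
    (rewardKernel d).comap
      (fun p : ((Fin d → ℝ) × History d t) × (Fin d → ℝ) => (p.1.1, p.2)) (by fun_prop)

instance {d : ℕ} (A : Algorithm d) (t : ℕ) : IsMarkovKernel (A.stepKernel t) := by
  unfold Algorithm.stepKernel; infer_instance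

/-- Given `β`, the law of the history of the first `t` rounds when `A` is run on the instance with
coefficient vector `β`. -/
def Algorithm.historyKernel {d : ℕ} (A : Algorithm d) :
    (t : ℕ) → Kernel (Fin d → ℝ) (History d t)
  | 0 => Kernel.const _ (Measure.dirac (fun i => i.elim0))
  | t + 1 => (A.historyKernel t ⊗ₖ A.stepKernel t).map
      (fun p : History d t × ((Fin d → ℝ) × ℝ) =>
        (Fin.snoc p.1 p.2 : Fin (t + 1) → (Fin d → ℝ) × ℝ))

theorem measurable_snoc (d t : ℕ) :
    Measurable (fun p : History d t × ((Fin d → ℝ) × ℝ) =>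
      (Fin.snoc p.1 p.2 : Fin (t + 1) → (Fin d → ℝ) × ℝ)) := by
  refine measurable_pi_iff.2 fun i => ?_
  refine Fin.lastCases ?_ (fun j => ?_) i
  · simpa only [Fin.snoc_last] using measurable_snd
  · simp only [Fin.snoc_castSucc]
    exact (measurable_pi_apply j).comp measurable_fst

instance {d : ℕ} (A : Algorithm d) (t : ℕ) : IsMarkovKernel (A.historyKernel t) := by
  induction t with
  | zero => unfold Algorithm.historyKernel; infer_instance
  | succ t ih =>
    unfold Algorithm.historyKernel
    exact Kernel.IsMarkovKernel.map _ (measurable_snoc d t)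

/-- A discrete distribution on `[-1,1]^d` whose probability mass function is fair for `β`. -/
def FairDiscrete {d : ℕ} (β : Fin d → ℝ) (ν : Measure (Fin d → ℝ)) : Prop :=
  (∃ S : Set (Fin d → ℝ), S.Countable ∧ S ⊆ choiceSet d ∧ ν Sᶜ = 0) ∧
    ∀ x ∈ choiceSet d, ∀ x' ∈ choiceSet d, x' ⬝ᵥ β ≤ x ⬝ᵥ β → ν {x'} ≤ ν {x}

/-- A continuous distribution on `[-1,1]^d` that has a probability density function which is fair
for `β`. -/
def FairContinuous {d : ℕ} (β : Fin d → ℝ) (ν : Measure (Fin d → ℝ)) : Prop :=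
  ∃ f : (Fin d → ℝ) → ℝ≥0∞, Measurable f ∧
    ν = (volume.restrict (choiceSet d)).withDensity f ∧
    ∀ x ∈ choiceSet d, ∀ x' ∈ choiceSet d, x' ⬝ᵥ β ≤ x ⬝ᵥ β → f x' ≤ f x

/-- Round-fairness of `π` for `β`: `π` is a (finite or countable) mixture of probability
distributions each of which is discrete or continuous and fair for `β`. -/
def RoundFair {d : ℕ} (β : Fin d → ℝ) (π : Measure (Fin d → ℝ)) : Prop :=
  ∃ (α : ℕ → ℝ≥0∞) (ν : ℕ → Measure (Fin d → ℝ)),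
    ∑' i, α i = 1 ∧ (∀ i, IsProbabilityMeasure (ν i)) ∧
    (∀ i, FairDiscrete β (ν i) ∨ FairContinuous β (ν i)) ∧
    π = Measure.sum (fun i => α i • ν i)

/-- Fairness over `T` rounds of an algorithm with a confidence parameter as its input: for every
input `δ ∈ (0,1]` and every `β ∈ [-1,1]^d`, with probability at least `1 - δ`, the distribution
used in each of the rounds is round-fair for `β`. -/
def IsFair {d : ℕ} (A : ℝ → Algorithm d) (T : ℕ) : Prop :=
  ∀ δ : ℝ, 0 < δ → δ ≤ 1 → ∀ β ∈ choiceSet d,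
    ENNReal.ofReal (1 - δ) ≤
      (A δ).historyKernel T β
        {h | ∀ t : Fin T, RoundFair β ((A δ).policy t (fun i : Fin t => h (Fin.castLE t.2.le i)))}

/-- The largest expected reward of a single choice. -/
def optValue {d : ℕ} (β : Fin d → ℝ) : ℝ := sSup ((fun x => x ⬝ᵥ β) '' choiceSet d)

/-- The (pseudo-)regret of the choices recorded in the history `h`. -/
def regret {d T : ℕ} (β : Fin d → ℝ) (h : History d T) : ℝ :=
  ∑ t : Fin T, (optValue β - (h t).1 ⬝ᵥ β)

/-- The gap of the instance `β`: the infimum of `⟨x⋆ - x, β⟩` over the extreme points `x ≠ x⋆` of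
the choice set, `x⋆` being a best choice (so it is `0` when the best choice is not unique). -/
def gap {d : ℕ} (β : Fin d → ℝ) : ℝ :=
  sInf {r | ∃ xs ∈ choiceSet d, (∀ y ∈ choiceSet d, y ⬝ᵥ β ≤ xs ⬝ᵥ β) ∧
    ∃ x ∈ Set.extremePoints ℝ (choiceSet d), x ≠ xs ∧ r = (xs - x) ⬝ᵥ β}

end

end FairBandit

/-! The prior is uniform on the two instances `(1, ±Δ/2, 1, …, 1)`, whose rewards differ by at most
`Δ` on every choice. Three facts force regret of order `δ / Δ`.

Geometry: the directions `(-s/2, ±s/Δ, 0, …, 0)` are each neutral for one of the two instances, and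
they add up to `(-s, 0, …, 0)`. A distribution fair for both instances therefore puts no less mass
on a slab moved down in the first coordinate. Comparing the top slab with its disjoint lower
translates bounds the probability of `1 - x 0 < u` by `2 * u` (`measure_one_sub_lt_le`). Since `1 -
x 0` is a lower bound for the regret of a round, such rounds are costly.

Information: with uniform noise, the two laws coincide on histories whose rewards are possible under
both instances (`restrict_consistent_eq`). Unfairness for the wrong instance on such histories is
thus as unlikely under the true instance as under the wrong one. A round rules out one of the
instances with probability at most `Δ`.

Budget: while fairness for both instances lasts, a potential argument shows that a cost budget `r`
pays for at most `8 * r` rounds in expectation (`lintegral_good_add_sum_affordable_le`). Hence the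
cost stays below `r` with probability at most `2 * δ' + Δ * 8 * r + 8 * r / T`: unfairness, early
identification, or survival of all rounds (`historyKernel_cost_lt_le`). With `r = δ / (32 * Δ)` and
`T ≥ 1 / Δ` this is at most `δ`. No union bound over rounds is needed. -/

namespace FairBandit

/-! ### The law of a history, one round at a time -/

/-- Drop the last round of a history. -/
def History.pre {d t : ℕ} (h : History d (t + 1)) : History d t := fun i => h i.castSucc

/-- Append a round to a history. -/
def History.push {d t : ℕ} (h : History d t) (p : (Fin d → ℝ) × ℝ) : History d (t + 1) :=
  (Fin.snoc h p : Fin (t + 1) → (Fin d → ℝ) × ℝ)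

@[simp] theorem History.pre_push {d t : ℕ} (h : History d t) (p : (Fin d → ℝ) × ℝ) :
    (h.push p).pre = h := by
  funext i; simp [History.pre, History.push]

@[simp] theorem History.push_last {d t : ℕ} (h : History d t) (p : (Fin d → ℝ) × ℝ) :
    h.push p (Fin.last t) = p := by
  simp [History.push]

@[simp] theorem History.push_castSucc {d t : ℕ} (h : History d t) (p : (Fin d → ℝ) × ℝ)
    (i : Fin t) : h.push p i.castSucc = h i := by
  simp [History.push]

@[fun_prop]
theorem History.measurable_pre {d t : ℕ} :
    Measurable (History.pre : History d (t + 1) → History d t) :=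
  measurable_pi_iff.2 fun i => measurable_pi_apply i.castSucc

theorem History.measurable_push {d t : ℕ} :
    Measurable (fun p : History d t × ((Fin d → ℝ) × ℝ) => p.1.push p.2) :=
  measurable_snoc d t

theorem lintegral_rewardKernel {d : ℕ} (p : (Fin d → ℝ) × (Fin d → ℝ)) {f : ℝ → ℝ≥0∞}
    (hf : Measurable f) :
    ∫⁻ y, f y ∂(rewardKernel d p) = ∫⁻ η, f (p.2 ⬝ᵥ p.1 + η) ∂noise := by
  unfold rewardKernel
  rw [Kernel.lintegral_map _ (by fun_prop) _ hf, Kernel.lintegral_deterministic_prod _ _ _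
    (by fun_prop)]
  rfl

theorem lintegral_stepKernel {d t : ℕ} (A : Algorithm d) (β : Fin d → ℝ) (h : History d t)
    {f : (Fin d → ℝ) × ℝ → ℝ≥0∞} (hf : Measurable f) :
    ∫⁻ p, f p ∂(A.stepKernel t (β, h)) =
      ∫⁻ x, ∫⁻ η, f (x, x ⬝ᵥ β + η) ∂noise ∂(A.policy t h) := by
  unfold Algorithm.stepKernel
  rw [Kernel.lintegral_compProd _ _ _ hf, Kernel.lintegral_comap]
  refine lintegral_congr fun x => ?_
  rw [Kernel.lintegral_comap, lintegral_rewardKernel _ (by fun_prop)]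

theorem lintegral_historyKernel_succ {d t : ℕ} (A : Algorithm d) (β : Fin d → ℝ)
    {f : History d (t + 1) → ℝ≥0∞} (hf : Measurable f) :
    ∫⁻ h, f h ∂(A.historyKernel (t + 1) β) =
      ∫⁻ h, ∫⁻ x, ∫⁻ η, f (h.push (x, x ⬝ᵥ β + η)) ∂noise ∂(A.policy t h)
        ∂(A.historyKernel t β) := by
  have hf' : Measurable fun p : History d t × ((Fin d → ℝ) × ℝ) => f (p.1.push p.2) :=
    hf.comp History.measurable_push
  rw [Algorithm.historyKernel, Kernel.lintegral_map _ (measurable_snoc d t) _ hf]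
  change ∫⁻ p, f (p.1.push p.2) ∂((A.historyKernel t ⊗ₖ A.stepKernel t) β) = _
  rw [Kernel.lintegral_compProd _ _ _ hf']
  refine lintegral_congr fun h => ?_
  exact lintegral_stepKernel A β h (hf'.comp measurable_prodMk_left)

theorem historyKernel_pre_preimage {d t : ℕ} (A : Algorithm d) (β : Fin d → ℝ)
    {S : Set (History d t)} (hS : MeasurableSet S) :
    A.historyKernel (t + 1) β (History.pre ⁻¹' S) = A.historyKernel t β S := by
  rw [← lintegral_indicator_one (History.measurable_pre hS),
    lintegral_historyKernel_succ A β (measurable_one.indicator (History.measurable_pre hS)),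
    ← lintegral_indicator_one hS]
  refine lintegral_congr fun h => ?_
  by_cases hh : h ∈ S <;> simp [indicator, hh]

/-- Histories all of whose proper prefixes lie in the given sets. -/
def always {d : ℕ} (M : ∀ t, Set (History d t)) : ∀ t, Set (History d t)
  | 0 => univ
  | t + 1 => History.pre ⁻¹' (always M t ∩ M t)

theorem measurableSet_always {d : ℕ} {M : ∀ t, Set (History d t)}
    (hM : ∀ t, MeasurableSet (M t)) : ∀ t, MeasurableSet (always M t)
  | 0 => MeasurableSet.univ
  | t + 1 => History.measurable_pre ((measurableSet_always hM t).inter (hM t))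

theorem mem_always {d : ℕ} {M : ∀ t, Set (History d t)} : ∀ {t : ℕ} {h : History d t},
    h ∈ always M t ↔ ∀ i : Fin t, (fun j : Fin i => h (Fin.castLE i.2.le j)) ∈ M i
  | 0, h => by simp [always]
  | t + 1, h => by
    rw [always, mem_preimage, mem_inter_iff, mem_always, Fin.forall_fin_succ']
    rfl

theorem historyKernel_compl_always_succ {d t : ℕ} (A : Algorithm d) (β : Fin d → ℝ)
    {M : ∀ t, Set (History d t)} (hM : ∀ t, MeasurableSet (M t)) :
    A.historyKernel (t + 1) β (always M (t + 1))ᶜ =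
      A.historyKernel t β (always M t)ᶜ + A.historyKernel t β (always M t \ M t) := by
  rw [always, ← preimage_compl, historyKernel_pre_preimage A β
    ((measurableSet_always hM t).inter (hM t)).compl, ← measure_union
      (disjoint_compl_left.mono_right sdiff_subset) ((measurableSet_always hM t).diff (hM t))]
  congr 1
  ext h
  by_cases h1 : h ∈ always M t <;> by_cases h2 : h ∈ M t <;> simp [h1, h2]

/-- Decomposition by the first prefix outside `M`. Exactness of the sum is what lets unfairness be
charged once rather than once per round. -/
theorem historyKernel_compl_always_eq_sum {d : ℕ} (A : Algorithm d) (β : Fin d → ℝ)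
    {M : ∀ t, Set (History d t)} (hM : ∀ t, MeasurableSet (M t)) (T : ℕ) :
    A.historyKernel T β (always M T)ᶜ =
      ∑ t ∈ Finset.range T, A.historyKernel t β (always M t \ M t) := by
  induction T with
  | zero => simp [always]
  | succ t ih => rw [historyKernel_compl_always_succ A β hM, ih, Finset.sum_range_succ]

theorem ae_mem_choiceSet {d : ℕ} (A : Algorithm d) (β : Fin d → ℝ) (T : ℕ) :
    ∀ᵐ h ∂(A.historyKernel T β), ∀ i, (h i).1 ∈ choiceSet d := by
  have hC : MeasurableSet (choiceSet d) := measurableSet_Icc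
  have hS : ∀ t, MeasurableSet {h : History d t | ∀ i, (h i).1 ∈ choiceSet d} := fun t => by
    rw [ofPred_forall]
    exact MeasurableSet.iInter fun i =>
      (by fun_prop : Measurable fun h : History d t => (h i).1) hC
  induction T with
  | zero => exact Filter.Eventually.of_forall fun h i => i.elim0
  | succ t ih =>
    have h1 : ∀ᵐ h ∂(A.historyKernel (t + 1) β), ∀ i, (h.pre i).1 ∈ choiceSet d := by
      rw [ae_iff] at ih ⊢
      exact (historyKernel_pre_preimage A β (hS t).compl).trans ih
    have h2 : ∀ᵐ h ∂(A.historyKernel (t + 1) β), (h (Fin.last t)).1 ∈ choiceSet d := by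
      have hm : MeasurableSet {h : History d (t + 1) | (h (Fin.last t)).1 ∈ choiceSet d}ᶜ :=
        ((by fun_prop : Measurable fun h : History d (t + 1) => (h (Fin.last t)).1) hC).compl
      rw [ae_iff]
      change (A.historyKernel (t + 1) β) {h | (h (Fin.last t)).1 ∈ choiceSet d}ᶜ = 0
      rw [← lintegral_indicator_one hm,
        lintegral_historyKernel_succ A β (measurable_one.indicator hm)]
      refine (lintegral_congr fun h => ?_).trans lintegral_zero
      rw [lintegral_eq_zero_iff' ?_]
      · filter_upwards [measure_eq_zero_iff_ae_notMem.1 (A.support t h)] with x hx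
        simp only [mem_compl_iff, not_not] at hx
        simp [indicator, hx]
      · refine Measurable.aemeasurable ?_
        have : (fun x => ∫⁻ η, ({h : History d (t + 1) | (h (Fin.last t)).1 ∈ choiceSet d}ᶜ).indicator
            (1 : History d (t + 1) → ℝ≥0∞) (h.push (x, x ⬝ᵥ β + η)) ∂noise) = (choiceSet d)ᶜ.indicator 1 := by
          funext x
          by_cases hx : x ∈ choiceSet d <;> simp [indicator, hx]
        rw [this]
        exact measurable_one.indicator hC.compl
    filter_upwards [h1, h2] with h h1 h2
    exact Fin.forall_fin_succ'.2 ⟨h1, h2⟩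

/-! ### Histories consistent with two instances -/

theorem lintegral_noise_const_add (a : ℝ) (f : ℝ → ℝ≥0∞) :
    ∫⁻ η, f (a + η) ∂noise = 2⁻¹ * ∫⁻ y, (Icc (a - 1) (a + 1)).indicator f y := by
  have : ∀ η, (Icc (-1 : ℝ) 1).indicator (fun η => f (a + η)) η =
      (Icc (a - 1) (a + 1)).indicator f (a + η) := fun η => by
    by_cases hη : η ∈ Icc (-1 : ℝ) 1
    · rw [indicator_of_mem hη, indicator_of_mem]
      exact ⟨by linarith [hη.1], by linarith [hη.2]⟩
    · rw [indicator_of_notMem hη, indicator_of_notMem]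
      exact fun h => hη ⟨by linarith [h.1], by linarith [h.2]⟩
  rw [noise, ProbabilityTheory.cond, lintegral_smul_measure, ← lintegral_indicator measurableSet_Icc,
    lintegral_congr this, lintegral_add_left_eq_self]
  norm_num [Real.volume_Icc]

/-- Histories whose rewards have positive likelihood under both instances. -/
def consistent {d : ℕ} (β β' : Fin d → ℝ) (t : ℕ) : Set (History d t) :=
  {h | ∀ i, |(h i).2 - (h i).1 ⬝ᵥ β| ≤ 1 ∧ |(h i).2 - (h i).1 ⬝ᵥ β'| ≤ 1}

theorem measurableSet_consistent {d : ℕ} (β β' : Fin d → ℝ) (t : ℕ) :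
    MeasurableSet (consistent β β' t) := by
  rw [consistent, ofPred_forall]
  refine MeasurableSet.iInter fun i => ?_
  have hm : ∀ γ : Fin d → ℝ, Measurable fun h : History d t => |(h i).2 - (h i).1 ⬝ᵥ γ| :=
    fun γ => by simp only [dotProduct]; fun_prop
  exact (measurableSet_le (hm β) measurable_const).inter
    (measurableSet_le (hm β') measurable_const)

theorem push_mem_consistent {d t : ℕ} {β β' : Fin d → ℝ} {h : History d t}
    {p : (Fin d → ℝ) × ℝ} :
    h.push p ∈ consistent β β' (t + 1) ↔
      h ∈ consistent β β' t ∧ |p.2 - p.1 ⬝ᵥ β| ≤ 1 ∧ |p.2 - p.1 ⬝ᵥ β'| ≤ 1 := by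
  simp [consistent, Fin.forall_fin_succ']

/-- Both reward laws have the constant density `1/2` on the overlap of their supports. -/
theorem lintegral_noise_comm (a b : ℝ) (f : ℝ → ℝ≥0∞) :
    ∫⁻ η, {y : ℝ | |y - a| ≤ 1 ∧ |y - b| ≤ 1}.indicator f (a + η) ∂noise =
      ∫⁻ η, {y : ℝ | |y - a| ≤ 1 ∧ |y - b| ≤ 1}.indicator f (b + η) ∂noise := by
  rw [lintegral_noise_const_add, lintegral_noise_const_add, indicator_indicator,
    indicator_indicator]
  congr! 4
  ext y
  simp only [mem_inter_iff, mem_Icc, mem_ofPred_eq, abs_le]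
  constructor <;> rintro ⟨-, ⟨h1, h2⟩, h3, h4⟩ <;>
    exact ⟨⟨by linarith, by linarith⟩, ⟨h1, h2⟩, h3, h4⟩

/-- The policy sees only the history, and each consistent reward has likelihood ratio exactly 1, so
by induction the two laws agree without any loss. -/
theorem restrict_consistent_eq {d : ℕ} (A : Algorithm d) (β β' : Fin d → ℝ) (t : ℕ) :
    (A.historyKernel t β).restrict (consistent β β' t) =
      (A.historyKernel t β').restrict (consistent β β' t) := by
  induction t with
  | zero => rfl
  | succ t ih =>
    refine Measure.ext_of_lintegral _ fun f hf => ?_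
    have key : ∀ γ, ∫⁻ h in consistent β β' (t + 1), f h ∂(A.historyKernel (t + 1) γ) =
        ∫⁻ h in consistent β β' t, ∫⁻ x, ∫⁻ η, {y : ℝ | |y - x ⬝ᵥ β| ≤ 1 ∧ |y - x ⬝ᵥ β'| ≤ 1}.indicator
          (fun y => f (h.push (x, y))) (x ⬝ᵥ γ + η) ∂noise ∂(A.policy t h)
            ∂(A.historyKernel t γ) := fun γ => by
      rw [← lintegral_indicator (measurableSet_consistent _ _ _), lintegral_historyKernel_succ A γ
        (hf.indicator (measurableSet_consistent _ _ _)),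
        ← lintegral_indicator (measurableSet_consistent _ _ _)]
      refine lintegral_congr fun h => ?_
      by_cases hh : h ∈ consistent β β' t
      · rw [indicator_of_mem hh]
        simp only [indicator, push_mem_consistent, hh, true_and, mem_ofPred_eq]
      · simp [indicator, push_mem_consistent, hh]
    rw [key, key, ih]
    refine lintegral_congr fun h => lintegral_congr fun x => ?_
    exact lintegral_noise_comm _ _ _

theorem historyKernel_eq_of_subset_consistent {d t : ℕ} (A : Algorithm d) {β β' : Fin d → ℝ}
    {S : Set (History d t)} (hS : S ⊆ consistent β β' t) :
    A.historyKernel t β S = A.historyKernel t β' S := by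
  rw [← Measure.restrict_eq_self _ hS, restrict_consistent_eq, Measure.restrict_eq_self _ hS]

theorem noise_inconsistent_le (a b : ℝ) :
    noise {η | ¬ (|a + η - a| ≤ 1 ∧ |a + η - b| ≤ 1)} ≤ ENNReal.ofReal |a - b| := by
  have hm : MeasurableSet {η : ℝ | ¬ (|a + η - a| ≤ 1 ∧ |a + η - b| ≤ 1)} := by
    refine MeasurableSet.compl (s := {η : ℝ | (|a + η - a| ≤ 1 ∧ |a + η - b| ≤ 1)}) ?_
    have hm : ∀ c : ℝ, Measurable fun η : ℝ => |a + η - c| := fun c => by fun_prop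
    exact (measurableSet_le (hm a) measurable_const).inter
      (measurableSet_le (hm b) measurable_const)
  rw [noise, cond_apply' hm]
  -- The density `1/2` is bounded by 1; the lost factor 2 only affects the constant.
  have h2 : (volume (Icc (-1 : ℝ) 1))⁻¹ ≤ 1 := by
    rw [Real.volume_Icc, ENNReal.inv_le_one]
    norm_num
  refine (mul_le_mul_left h2 _).trans ?_
  rw [one_mul]
  rcases le_total b a with hab | hab
  · refine (measure_mono (t := Ioc (1 - (a - b)) 1) ?_).trans ?_
    · rintro η ⟨⟨h1, h2⟩, h3⟩
      simp only [mem_ofPred_eq, add_sub_cancel_left, abs_le] at h3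
      exact ⟨by grind, h2⟩
    · rw [Real.volume_Ioc, abs_of_nonneg (by linarith)]
      simp
  · refine (measure_mono (t := Ico (-1) (-1 + (b - a))) ?_).trans ?_
    · rintro η ⟨⟨h1, h2⟩, h3⟩
      simp only [mem_ofPred_eq, add_sub_cancel_left, abs_le] at h3
      exact ⟨h1, by grind⟩
    · rw [Real.volume_Ico, abs_of_nonpos (by linarith)]
      simp

/-! ### The accumulated cost of histories consistent with two instances -/

/-- If the cost `ρ` is small with at most proportional probability, then `8 * s⁺` is a potential for
the number of rounds that a total budget `s` lasts. -/
theorem lintegral_budget_le {α : Type*} [MeasurableSpace α] {π : Measure α}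
    [IsProbabilityMeasure π] {ρ : α → ℝ} (hρ : Measurable ρ) (hρ0 : ∀ x, 0 ≤ ρ x)
    (h : ∀ u, 0 < u → π {x | ρ x < u} ≤ ENNReal.ofReal (2 * u)) (s : ℝ) :
    ∫⁻ x, ENNReal.ofReal (8 * (s - ρ x)) ∂π + π {x | ρ x < s} ≤ ENNReal.ofReal (8 * s) := by
  have hm : ∀ u, MeasurableSet {x | ρ x < u} := fun u => measurableSet_lt hρ measurable_const
  rcases le_or_gt s 0 with hs | hs
  · have h1 : ∀ x, ENNReal.ofReal (8 * (s - ρ x)) = 0 := fun x =>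
      ENNReal.ofReal_of_nonpos (by linarith [hρ0 x])
    have h2 : {x | ρ x < s} = ∅ := by
      ext x; simp only [mem_ofPred_eq, mem_empty_iff_false, iff_false, not_lt]
      linarith [hρ0 x]
    simp [h1, h2]
  rcases le_or_gt s (1 / 4) with hs' | hs'
  -- Small budget: it survives with probability at most `2 * s`, and then potential plus count is at
  -- most `8 * s + 1 ≤ 3`, giving `6 * s`.
  · have h1 : ∫⁻ x, ENNReal.ofReal (8 * (s - ρ x)) ∂π ≤
        ENNReal.ofReal (8 * s) * π {x | ρ x < s} := by
      rw [← lintegral_indicator_const (hm s)]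
      refine lintegral_mono fun x => ?_
      by_cases hx : ρ x < s
      · rw [indicator_of_mem (show x ∈ {x | ρ x < s} from hx)]
        exact ENNReal.ofReal_le_ofReal (by linarith [hρ0 x])
      · rw [ENNReal.ofReal_of_nonpos (by linarith)]
        exact zero_le
    calc _ ≤ (ENNReal.ofReal (8 * s) + 1) * π {x | ρ x < s} := by
          rw [add_mul, one_mul]; gcongr
      _ ≤ (ENNReal.ofReal (8 * s) + ENNReal.ofReal 1) * ENNReal.ofReal (2 * s) := by
          rw [ENNReal.ofReal_one]; gcongr; exact h s hs
      _ ≤ ENNReal.ofReal (8 * s) := by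
          rw [← ENNReal.ofReal_add (by linarith) one_pos.le, ← ENNReal.ofReal_mul (by linarith)]
          exact ENNReal.ofReal_le_ofReal (by nlinarith)
  -- Large budget: with probability at least `1/2` the cost is at least `1/4` and the potential
  -- drops by 2. The expected drop of at least 1 pays for the round.
  · have h1 : ∫⁻ x, ENNReal.ofReal (8 * (s - ρ x)) ∂π ≤
        ENNReal.ofReal (8 * s - 2) + ENNReal.ofReal 2 * π {x | ρ x < 1 / 4} := by
      have : ENNReal.ofReal (8 * s - 2) = ∫⁻ _, ENNReal.ofReal (8 * s - 2) ∂π := by simp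
      rw [← lintegral_indicator_const (hm _), this, ← lintegral_add_left measurable_const]
      refine lintegral_mono fun x => ?_
      by_cases hx : ρ x < 1 / 4
      · rw [indicator_of_mem (show x ∈ {x | ρ x < 1 / 4} from hx),
          ← ENNReal.ofReal_add (by linarith) (by norm_num)]
        exact ENNReal.ofReal_le_ofReal (by linarith [hρ0 x])
      · exact (ENNReal.ofReal_le_ofReal (by linarith)).trans le_self_add
    calc _ ≤ ENNReal.ofReal (8 * s - 2) + ENNReal.ofReal 2 * ENNReal.ofReal (2 * (1 / 4)) +
          ENNReal.ofReal 1 := by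
          rw [ENNReal.ofReal_one]
          gcongr
          · exact h1.trans (by gcongr; exact h _ (by norm_num))
          · exact prob_le_one
      _ = ENNReal.ofReal (8 * s) := by
          rw [← ENNReal.ofReal_mul (by norm_num), ← ENNReal.ofReal_add (by linarith) (by norm_num),
            ← ENNReal.ofReal_add (by linarith) (by norm_num)]
          congr 1; ring

/-- The total cost of the choices recorded in a history. -/
noncomputable def cost {d t : ℕ} (ρ : (Fin d → ℝ) → ℝ) (h : History d t) : ℝ :=
  ∑ i, ρ (h i).1

theorem cost_eq_pre_add {d t : ℕ} (ρ : (Fin d → ℝ) → ℝ) (h : History d (t + 1)) :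
    cost ρ h = cost ρ h.pre + ρ (h (Fin.last t)).1 :=
  Fin.sum_univ_castSucc _

@[fun_prop]
theorem measurable_cost {d t : ℕ} {ρ : (Fin d → ℝ) → ℝ} (hρ : Measurable ρ) :
    Measurable (cost ρ : History d t → ℝ) := by
  unfold cost; fun_prop

/-- The histories consistent with both instances all of whose prefixes lie in `M` and `M'`. -/
def good {d : ℕ} (β β' : Fin d → ℝ) (M M' : ∀ t, Set (History d t)) (t : ℕ) :
    Set (History d t) :=
  consistent β β' t ∩ (always M t ∩ always M' t)

/-- The histories of total cost below `r` that were good before the last round, in which the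
choice was still drawn as for a good history. -/
def affordable {d : ℕ} (β β' : Fin d → ℝ) (M M' : ∀ t, Set (History d t))
    (ρ : (Fin d → ℝ) → ℝ) (r : ℝ) (t : ℕ) : Set (History d (t + 1)) :=
  {h | h.pre ∈ good β β' M M' t ∩ (M t ∩ M' t) ∧ cost ρ h < r}

/-- The histories in which the last reward rules out one of the instances. -/
def inconsistentLast {d : ℕ} (β β' : Fin d → ℝ) (t : ℕ) : Set (History d (t + 1)) :=
  {h | ¬ (|(h (Fin.last t)).2 - (h (Fin.last t)).1 ⬝ᵥ β| ≤ 1 ∧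
    |(h (Fin.last t)).2 - (h (Fin.last t)).1 ⬝ᵥ β'| ≤ 1)}

theorem measurableSet_inconsistentLast {d : ℕ} (β β' : Fin d → ℝ) (t : ℕ) :
    MeasurableSet (inconsistentLast β β' t) := by
  have hm : ∀ γ : Fin d → ℝ, Measurable fun h : History d (t + 1) =>
      |(h (Fin.last t)).2 - (h (Fin.last t)).1 ⬝ᵥ γ| :=
    fun γ => by simp only [dotProduct]; fun_prop
  exact ((measurableSet_le (hm β) measurable_const).inter
    (measurableSet_le (hm β') measurable_const)).compl

section

variable {d : ℕ} {β β' : Fin d → ℝ} {M M' : ∀ t, Set (History d t)} {ρ : (Fin d → ℝ) → ℝ}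

theorem good_zero : good β β' M M' 0 = univ := by
  ext h; simp [good, always, consistent]

theorem mem_good_succ {t : ℕ} {h : History d (t + 1)} :
    h ∈ good β β' M M' (t + 1) ↔
      h.pre ∈ good β β' M M' t ∩ (M t ∩ M' t) ∧ h ∉ inconsistentLast β β' t := by
  have : h ∈ consistent β β' (t + 1) ↔
      h.pre ∈ consistent β β' t ∧ h ∉ inconsistentLast β β' t := by
    simp only [consistent, inconsistentLast, mem_ofPred_eq, not_not, Fin.forall_fin_succ']
    rfl
  simp only [good, always, mem_inter_iff, mem_preimage, this]
  tauto

theorem measurableSet_good (hM : ∀ t, MeasurableSet (M t)) (hM' : ∀ t, MeasurableSet (M' t))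
    (t : ℕ) : MeasurableSet (good β β' M M' t) :=
  (measurableSet_consistent _ _ _).inter
    ((measurableSet_always hM t).inter (measurableSet_always hM' t))

theorem measurableSet_affordable (hM : ∀ t, MeasurableSet (M t))
    (hM' : ∀ t, MeasurableSet (M' t)) (hρ : Measurable ρ) (r : ℝ) (t : ℕ) :
    MeasurableSet (affordable β β' M M' ρ r t) :=
  (History.measurable_pre ((measurableSet_good hM hM' t).inter ((hM t).inter (hM' t)))).inter
    (measurableSet_lt (measurable_cost hρ) measurable_const)

/-- Costs are nonnegative and goodness passes to prefixes, so an affordable history has an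
affordable prefix. -/
theorem historyKernel_affordable_antitone (A : Algorithm d) (hM : ∀ t, MeasurableSet (M t))
    (hM' : ∀ t, MeasurableSet (M' t)) (hρ : Measurable ρ) (hρ0 : ∀ x, 0 ≤ ρ x) (r : ℝ) :
    Antitone fun t => A.historyKernel (t + 1) β (affordable β β' M M' ρ r t) := by
  refine antitone_nat_of_succ_le fun t => ?_
  rw [← historyKernel_pre_preimage A β (measurableSet_affordable hM hM' hρ r t)]
  refine measure_mono fun h hh => ⟨(mem_good_succ.1 hh.1.1).1, ?_⟩
  have := hh.2
  rw [cost_eq_pre_add] at this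
  linarith [hρ0 (h (Fin.last (t + 1))).1]

/-- `lintegral_budget_le` applied to the remaining budget `r - cost ρ h` makes the potential on good
histories plus the number of affordable rounds so far a supermartingale. The sum is thus the
expected number of affordable rounds. -/
theorem lintegral_good_add_sum_affordable_le (A : Algorithm d) (hM : ∀ t, MeasurableSet (M t))
    (hM' : ∀ t, MeasurableSet (M' t)) (hρ : Measurable ρ) (hρ0 : ∀ x, 0 ≤ ρ x)
    (hMM' : ∀ t, ∀ h ∈ M t ∩ M' t, ∀ u, 0 < u →
      A.policy t h {x | ρ x < u} ≤ ENNReal.ofReal (2 * u)) (r : ℝ) (T : ℕ) :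
    ∫⁻ h in good β β' M M' T, ENNReal.ofReal (8 * (r - cost ρ h)) ∂(A.historyKernel T β) +
      ∑ t ∈ Finset.range T, A.historyKernel (t + 1) β (affordable β β' M M' ρ r t) ≤
        ENNReal.ofReal (8 * r) := by
  induction T with
  | zero => simp [good_zero, cost, Algorithm.historyKernel]
  | succ t ih =>
    refine le_trans ?_ ih
    rw [Finset.sum_range_succ, add_comm (Finset.sum _ _), ← add_assoc]
    gcongr ?_ + _
    have hA := measurableSet_affordable (β := β) (β' := β') hM hM' hρ r t
    have hG := measurableSet_good (β := β) (β' := β') hM hM' (t + 1)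
    have hf : Measurable fun h : History d (t + 1) => ENNReal.ofReal (8 * (r - cost ρ h)) := by
      fun_prop
    have hsum : Measurable fun h => (good β β' M M' (t + 1)).indicator
        (fun h => ENNReal.ofReal (8 * (r - cost ρ h))) h +
          (affordable β β' M M' ρ r t).indicator 1 h :=
      (hf.indicator hG).add (measurable_one.indicator hA)
    rw [← lintegral_indicator hG, ← lintegral_indicator_one hA,
      ← lintegral_add_left (hf.indicator hG),
      lintegral_historyKernel_succ A β hsum,
      ← lintegral_indicator (measurableSet_good hM hM' t)]
    refine lintegral_mono fun h => ?_
    by_cases hh : h ∈ good β β' M M' t ∩ (M t ∩ M' t)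
    · rw [indicator_of_mem hh.1]
      refine le_trans ?_ (lintegral_budget_le hρ hρ0 (hMM' t h hh.2) (r - cost ρ h))
      rw [← lintegral_indicator_one (measurableSet_lt hρ measurable_const),
        ← lintegral_add_left (by fun_prop)]
      refine lintegral_mono fun x => ?_
      refine (lintegral_mono (g := fun _ => ENNReal.ofReal (8 * (r - cost ρ h - ρ x)) +
        {x | ρ x < r - cost ρ h}.indicator 1 x) fun η => ?_).trans (by simp)
      refine add_le_add ?_ (le_of_eq ?_)
      · refine (indicator_le_self _ _ _).trans (le_of_eq ?_)
        rw [cost_eq_pre_add]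
        simp [sub_sub]
      · simp [indicator, affordable, hh, cost_eq_pre_add, lt_sub_iff_add_lt']
    · refine le_of_eq_of_le ?_ zero_le
      simp [indicator, affordable, mem_good_succ, hh]

/-- Affordability is decided by the past and the last choice, before the last noise is drawn; given
these, the reward is inconsistent with probability at most `D`. -/
theorem historyKernel_affordable_inter_inconsistentLast_le (A : Algorithm d)
    (hM : ∀ t, MeasurableSet (M t)) (hM' : ∀ t, MeasurableSet (M' t)) (hρ : Measurable ρ)
    {D : ℝ} (hD : ∀ x ∈ choiceSet d, |x ⬝ᵥ β - x ⬝ᵥ β'| ≤ D) (r : ℝ) (t : ℕ) :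
    A.historyKernel (t + 1) β (affordable β β' M M' ρ r t ∩ inconsistentLast β β' t) ≤
      ENNReal.ofReal D * A.historyKernel (t + 1) β (affordable β β' M M' ρ r t) := by
  have hA := measurableSet_affordable (β := β) (β' := β') hM hM' hρ r t
  have hI := measurableSet_inconsistentLast β β' t
  rw [← lintegral_indicator_one (hA.inter hI), ← lintegral_indicator_one hA,
    lintegral_historyKernel_succ A β (measurable_one.indicator (hA.inter hI)),
    lintegral_historyKernel_succ A β (measurable_one.indicator hA),
    ← lintegral_const_mul' _ _ ENNReal.ofReal_ne_top]
  refine lintegral_mono fun h => ?_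
  rw [← lintegral_const_mul' _ _ ENNReal.ofReal_ne_top]
  refine lintegral_mono_ae ?_
  filter_upwards [measure_eq_zero_iff_ae_notMem.1 (A.support t h)] with x hx
  simp only [mem_compl_iff, not_not] at hx
  have hiff : ∀ η : ℝ, h.push (x, x ⬝ᵥ β + η) ∈ affordable β β' M M' ρ r t ↔
      h ∈ good β β' M M' t ∩ (M t ∩ M' t) ∧ cost ρ h + ρ x < r := fun η => by
    simp [affordable, cost_eq_pre_add]
  by_cases hh : h ∈ good β β' M M' t ∩ (M t ∩ M' t) ∧ cost ρ h + ρ x < r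
  · have h1 : ∀ η : ℝ, (affordable β β' M M' ρ r t).indicator (1 : History d (t + 1) → ℝ≥0∞)
        (h.push (x, x ⬝ᵥ β + η)) = 1 := fun η => indicator_of_mem ((hiff η).2 hh) _
    have h2 : ∀ η : ℝ, (affordable β β' M M' ρ r t ∩ inconsistentLast β β' t).indicator
        (1 : History d (t + 1) → ℝ≥0∞) (h.push (x, x ⬝ᵥ β + η)) =
        {η | ¬ (|x ⬝ᵥ β + η - x ⬝ᵥ β| ≤ 1 ∧ |x ⬝ᵥ β + η - x ⬝ᵥ β'| ≤ 1)}.indicator 1 η :=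
      fun η => by
        simp only [indicator, mem_inter_iff, hiff, hh, true_and, inconsistentLast,
          History.push_last, mem_ofPred_eq, Pi.one_apply]
    simp only [h1, h2, lintegral_one, measure_univ, mul_one]
    exact (lintegral_indicator_one_le _).trans
      ((noise_inconsistent_le _ _).trans (ENNReal.ofReal_le_ofReal (hD x hx)))
  · have h2 : ∀ η : ℝ, (affordable β β' M M' ρ r t ∩ inconsistentLast β β' t).indicator
        (1 : History d (t + 1) → ℝ≥0∞) (h.push (x, x ⬝ᵥ β + η)) = 0 := fun η =>
      indicator_of_notMem (fun hm => hh ((hiff η).1 hm.1)) _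
    simp [h2]

/-- At the first loss of goodness, the prefix leaves `M` or `M'`, or the next reward is
inconsistent; in the last case the round was affordable, since prefixes cost no more. -/
theorem historyKernel_diff_good_le (A : Algorithm d) (hM : ∀ t, MeasurableSet (M t))
    (hM' : ∀ t, MeasurableSet (M' t)) (hρ : Measurable ρ) (hρ0 : ∀ x, 0 ≤ ρ x) (r : ℝ) (T : ℕ) :
    A.historyKernel T β ({h | cost ρ h < r} \ good β β' M M' T) ≤
      ∑ t ∈ Finset.range T, A.historyKernel t β (good β β' M M' t \ M t) +
      ∑ t ∈ Finset.range T, A.historyKernel t β (good β β' M M' t \ M' t) +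
      ∑ t ∈ Finset.range T, A.historyKernel (t + 1) β
        (affordable β β' M M' ρ r t ∩ inconsistentLast β β' t) := by
  induction T with
  | zero => simp [good_zero]
  | succ t ih =>
    have hG := measurableSet_good (β := β) (β' := β') hM hM' t
    have hL : MeasurableSet {h : History d t | cost ρ h < r} :=
      measurableSet_lt (measurable_cost hρ) measurable_const
    have hsub : {h | cost ρ h < r} \ good β β' M M' (t + 1) ⊆
        (History.pre ⁻¹' ({h | cost ρ h < r} \ good β β' M M' t)) ∪
        (History.pre ⁻¹' (good β β' M M' t \ M t)) ∪
        (History.pre ⁻¹' (good β β' M M' t \ M' t)) ∪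
        (affordable β β' M M' ρ r t ∩ inconsistentLast β β' t) := by
      rintro h ⟨h1, h2⟩
      have h1' : cost ρ h < r := h1
      have h3 : cost ρ h.pre < r := by
        rw [cost_eq_pre_add] at h1'
        linarith [hρ0 (h (Fin.last t)).1]
      simp only [mem_good_succ, mem_union, mem_preimage, mem_sdiff, mem_inter_iff, affordable,
        mem_ofPred_eq] at h2 ⊢
      tauto
    refine (measure_mono hsub).trans ?_
    refine (measure_union_le _ _).trans ((add_le_add ((measure_union_le _ _).trans
      (add_le_add (measure_union_le _ _) le_rfl)) le_rfl).trans ?_)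
    rw [historyKernel_pre_preimage A β (hL.diff hG), historyKernel_pre_preimage A β (hG.diff (hM t)),
      historyKernel_pre_preimage A β (hG.diff (hM' t))]
    simp only [Finset.sum_range_succ]
    refine (add_le_add (add_le_add (add_le_add ih le_rfl) le_rfl) le_rfl).trans (le_of_eq ?_)
    ring

/-- If two instances differ by at most `D` on every choice, and the policy rarely makes choices of
small cost as long as the histories lie in `M` and `M'`, then the cost exceeds `r` except if the
history leaves `M` or `M'`, or with probability `O(r (D + 1 / T))`. -/
theorem historyKernel_cost_lt_le (A : Algorithm d) (hM : ∀ t, MeasurableSet (M t))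
    (hM' : ∀ t, MeasurableSet (M' t)) (hρ : Measurable ρ) (hρ0 : ∀ x, 0 ≤ ρ x)
    (hMM' : ∀ t, ∀ h ∈ M t ∩ M' t, ∀ u, 0 < u →
      A.policy t h {x | ρ x < u} ≤ ENNReal.ofReal (2 * u))
    {D : ℝ} (hD : ∀ x ∈ choiceSet d, |x ⬝ᵥ β - x ⬝ᵥ β'| ≤ D) (r : ℝ) {T : ℕ} (hT : 0 < T) :
    A.historyKernel T β {h | cost ρ h < r} ≤
      A.historyKernel T β (always M T)ᶜ + A.historyKernel T β' (always M' T)ᶜ +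
        ENNReal.ofReal D * ENNReal.ofReal (8 * r) + ENNReal.ofReal (8 * r) / T := by
  have hsum : ∑ t ∈ Finset.range T, A.historyKernel (t + 1) β (affordable β β' M M' ρ r t) ≤
      ENNReal.ofReal (8 * r) :=
    (le_add_of_nonneg_left zero_le).trans (lintegral_good_add_sum_affordable_le A hM hM' hρ hρ0 hMM' r T)
  have h1 : A.historyKernel T β ({h | cost ρ h < r} ∩ good β β' M M' T) ≤
      ENNReal.ofReal (8 * r) / T := by
    -- Staying good and cheap through round `T` makes all `T` rounds affordable, so `T` times this
    -- probability is at most `8 * r`.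
    rw [ENNReal.le_div_iff_mul_le (by simp [hT.ne']) (by simp), mul_comm, ← nsmul_eq_mul]
    have hle : ∀ t ∈ Finset.range T, A.historyKernel T β ({h | cost ρ h < r} ∩ good β β' M M' T) ≤
        A.historyKernel (t + 1) β (affordable β β' M M' ρ r t) := fun t ht => by
      obtain ⟨T, rfl⟩ := Nat.exists_eq_succ_of_ne_zero hT.ne'
      refine le_trans ?_ (historyKernel_affordable_antitone A hM hM' hρ hρ0 r
        (Nat.lt_succ_iff.1 (Finset.mem_range.1 ht)))
      exact measure_mono fun h hh => ⟨(mem_good_succ.1 hh.2).1, hh.1⟩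
    simpa using (Finset.card_nsmul_le_sum _ _ _ hle).trans hsum
  have h2 : ∑ t ∈ Finset.range T, A.historyKernel t β (good β β' M M' t \ M t) ≤
      A.historyKernel T β (always M T)ᶜ := by
    rw [historyKernel_compl_always_eq_sum A β hM]
    exact Finset.sum_le_sum fun t _ => measure_mono fun h hh => ⟨hh.1.2.1, hh.2⟩
  have h3 : ∑ t ∈ Finset.range T, A.historyKernel t β (good β β' M M' t \ M' t) ≤
      A.historyKernel T β' (always M' T)ᶜ := by
    rw [historyKernel_compl_always_eq_sum A β' hM']
    refine Finset.sum_le_sum fun t _ => ?_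
    -- Change of measure: good histories are consistent, so leaving `M'` can be measured under `β'`,
    -- where fairness controls it.
    rw [historyKernel_eq_of_subset_consistent A (β := β) (β' := β') fun h hh => hh.1.1]
    exact measure_mono fun h hh => ⟨hh.1.2.2, hh.2⟩
  have h4 : ∑ t ∈ Finset.range T, A.historyKernel (t + 1) β
      (affordable β β' M M' ρ r t ∩ inconsistentLast β β' t) ≤
        ENNReal.ofReal D * ENNReal.ofReal (8 * r) := by
    refine (Finset.sum_le_sum fun t _ =>
      historyKernel_affordable_inter_inconsistentLast_le A hM hM' hρ hD r t).trans ?_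
    rw [← Finset.mul_sum]
    gcongr
  rw [← measure_inter_add_sdiff _ (measurableSet_good (β := β) (β' := β') hM hM' T), add_comm]
  refine add_le_add ((historyKernel_diff_good_le A hM hM' hρ hρ0 r T).trans ?_) h1
  gcongr

end

/-! ### Fair distributions put more mass on better translates -/

theorem FairDiscrete.measure_le_preimage_sub {d : ℕ} {β : Fin d → ℝ} {ν : Measure (Fin d → ℝ)}
    (hν : FairDiscrete β ν) {A : Set (Fin d → ℝ)} (hA : A ⊆ choiceSet d) {v : Fin d → ℝ}
    (hAv : ∀ x ∈ A, x + v ∈ choiceSet d) (hv : 0 ≤ v ⬝ᵥ β) :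
    ν A ≤ ν ((fun x => x - v) ⁻¹' A) := by
  obtain ⟨⟨S, hS, -, hSν⟩, hfair⟩ := hν
  have hAS : (A ∩ S).Countable := hS.mono inter_subset_right
  calc ν A = ν (A ∩ S) := (measure_inter_conull hSν).symm
    _ = ν (⋃ x ∈ A ∩ S, {x}) := by rw [biUnion_of_singleton]
    _ = ∑' x : ↥(A ∩ S), ν {(x : Fin d → ℝ)} :=
      measure_biUnion hAS (by simp [Set.PairwiseDisjoint, Set.Pairwise,
        Function.onFun]) fun _ _ => measurableSet_singleton _
    _ ≤ ∑' x : ↥(A ∩ S), ν {(x : Fin d → ℝ) + v} :=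
      ENNReal.tsum_le_tsum fun x => hfair _ (hAv x x.2.1) _ (hA x.2.1)
        (by rw [add_dotProduct]; linarith)
    _ = ν (⋃ x ∈ A ∩ S, {x + v}) :=
      (measure_biUnion (f := fun x => {x + v}) hAS (by simp [Set.PairwiseDisjoint, Set.Pairwise, Function.onFun])
        fun _ _ => measurableSet_singleton _).symm
    _ ≤ ν ((fun x => x - v) ⁻¹' A) := by
      refine measure_mono (iUnion₂_subset fun x hx => ?_)
      simpa using hx.1

/-- Translation invariance of Lebesgue measure turns the pointwise inequality `f x ≤ f (x + v)` into
one of masses. -/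
theorem FairContinuous.measure_le_preimage_sub {d : ℕ} {β : Fin d → ℝ}
    {ν : Measure (Fin d → ℝ)} (hν : FairContinuous β ν) {A : Set (Fin d → ℝ)}
    (hAm : MeasurableSet A) (hA : A ⊆ choiceSet d) {v : Fin d → ℝ}
    (hAv : ∀ x ∈ A, x + v ∈ choiceSet d) (hv : 0 ≤ v ⬝ᵥ β) :
    ν A ≤ ν ((fun x => x - v) ⁻¹' A) := by
  obtain ⟨f, hf, rfl, hfair⟩ := hν
  have hBm : MeasurableSet ((fun x => x - v) ⁻¹' A) := (measurable_sub_const v) hAm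
  have hB : (fun x => x - v) ⁻¹' A ⊆ choiceSet d := fun x hx => by
    simpa using hAv _ hx
  rw [withDensity_apply _ hAm, withDensity_apply _ hBm, Measure.restrict_restrict hAm,
    Measure.restrict_restrict hBm, inter_eq_left.2 hA, inter_eq_left.2 hB,
    ← lintegral_indicator hAm, ← lintegral_indicator hBm,
    ← lintegral_add_right_eq_self (((fun x => x - v) ⁻¹' A).indicator f) v]
  refine lintegral_mono fun x => ?_
  by_cases hx : x ∈ A
  · rw [indicator_of_mem hx, indicator_of_mem (by simpa using hx)]
    exact hfair _ (hAv x hx) _ (hA hx) (by rw [add_dotProduct]; linarith)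
  · rw [indicator_of_notMem hx]
    exact zero_le

theorem RoundFair.measure_le_preimage_sub {d : ℕ} {β : Fin d → ℝ} {π : Measure (Fin d → ℝ)}
    (hπ : RoundFair β π) {A : Set (Fin d → ℝ)} (hAm : MeasurableSet A)
    (hA : A ⊆ choiceSet d) {v : Fin d → ℝ} (hAv : ∀ x ∈ A, x + v ∈ choiceSet d)
    (hv : 0 ≤ v ⬝ᵥ β) :
    π A ≤ π ((fun x => x - v) ⁻¹' A) := by
  obtain ⟨α, ν, -, -, hν, rfl⟩ := hπ
  rw [Measure.sum_apply _ hAm, Measure.sum_apply _ ((measurable_sub_const v) hAm)]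
  refine ENNReal.tsum_le_tsum fun i => ?_
  rw [Measure.smul_apply, Measure.smul_apply]
  refine mul_le_mul_right ?_ (α i)
  exact (hν i).elim (fun h => h.measure_le_preimage_sub hA hAv hv)
    fun h => h.measure_le_preimage_sub hAm hA hAv hv

/-- `π` puts at least as much mass on the translate `A + v` as on `A`, for all pairs `(A, v)` in
`𝒟` for which `v` is an improvement for `β` and both sets consist of possible choices. -/
def TranslationFair {d : ℕ} (𝒟 : Set (Set (Fin d → ℝ) × (Fin d → ℝ))) (β : Fin d → ℝ)
    (π : Measure (Fin d → ℝ)) : Prop :=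
  ∀ p ∈ {p ∈ 𝒟 | p.1 ⊆ choiceSet d ∧ (∀ x ∈ p.1, x + p.2 ∈ choiceSet d) ∧ 0 ≤ p.2 ⬝ᵥ β},
    π p.1 ≤ π ((fun x => x - p.2) ⁻¹' p.1)

theorem RoundFair.translationFair {d : ℕ} {β : Fin d → ℝ} {π : Measure (Fin d → ℝ)}
    (hπ : RoundFair β π) {𝒟 : Set (Set (Fin d → ℝ) × (Fin d → ℝ))}
    (h𝒟 : ∀ p ∈ 𝒟, MeasurableSet p.1) : TranslationFair 𝒟 β π :=
  fun p hp => hπ.measure_le_preimage_sub (h𝒟 p hp.1) hp.2.1 hp.2.2.1 hp.2.2.2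

/-- Countably many tests replace round-fairness by a weaker condition that is visibly measurable in
the history. -/
theorem measurableSet_translationFair {d t : ℕ} {𝒟 : Set (Set (Fin d → ℝ) × (Fin d → ℝ))}
    (h𝒟 : ∀ p ∈ 𝒟, MeasurableSet p.1) (h𝒟c : 𝒟.Countable) (β : Fin d → ℝ) (A : Algorithm d) :
    MeasurableSet {h : History d t | TranslationFair 𝒟 β (A.policy t h)} := by
  simp only [TranslationFair, ofPred_forall]
  refine MeasurableSet.biInter (h𝒟c.mono (sep_subset _ _)) fun p hp => ?_
  exact measurableSet_le (Kernel.measurable_coe _ (h𝒟 p hp.1))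
    (Kernel.measurable_coe _ ((measurable_sub_const p.2) (h𝒟 p hp.1)))

/-! ### Distributions fair for two instances that disagree in one coordinate -/

/-- The vector `(b, c, e, …, e)`. -/
def planeVec (n : ℕ) (b c e : ℝ) : Fin (n + 2) → ℝ :=
  Matrix.vecCons b (Matrix.vecCons c fun _ => e)

@[simp] theorem planeVec_zero (n : ℕ) (b c e : ℝ) : planeVec n b c e 0 = b := rfl

@[simp] theorem planeVec_one (n : ℕ) (b c e : ℝ) : planeVec n b c e 1 = c := rfl

@[simp] theorem planeVec_succ_succ (n : ℕ) (b c e : ℝ) (i : Fin n) :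
    planeVec n b c e i.succ.succ = e := rfl

theorem planeVec_zero_dotProduct (n : ℕ) (b c b' c' e' : ℝ) :
    planeVec n b c 0 ⬝ᵥ planeVec n b' c' e' = b * b' + c * c' := by
  simp [dotProduct, Fin.sum_univ_succ, planeVec]

theorem mem_choiceSet {d : ℕ} {x : Fin d → ℝ} : x ∈ choiceSet d ↔ ∀ i, x i ∈ Icc (-1 : ℝ) 1 := by
  simp only [choiceSet, mem_Icc, Pi.le_def, forall_and]

theorem mem_choiceSet_add_two {n : ℕ} {x : Fin (n + 2) → ℝ} : x ∈ choiceSet (n + 2) ↔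
    x 0 ∈ Icc (-1 : ℝ) 1 ∧ x 1 ∈ Icc (-1 : ℝ) 1 ∧ ∀ i : Fin n, x i.succ.succ ∈ Icc (-1 : ℝ) 1 := by
  simp only [mem_choiceSet, Fin.forall_fin_succ]
  rfl

/-- The half line of the nonnegative, or of the negative numbers. -/
def halfLine (c : Bool) : Set ℝ := if c then Ici 0 else Iio 0

/-- The choices with first coordinate in `(a - w, a]`. -/
def slab (n : ℕ) (w a : ℝ) : Set (Fin (n + 2) → ℝ) :=
  {x | x ∈ choiceSet (n + 2) ∧ x 0 ∈ Ioc (a - w) a}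

theorem measurableSet_slab (n : ℕ) (w a : ℝ) : MeasurableSet (slab n w a) :=
  measurableSet_Icc.inter ((measurable_pi_apply 0) measurableSet_Ioc)

/-- The choices of a slab whose second coordinate lies in a half line. -/
def halfSlab (n : ℕ) (w a : ℝ) (c : Bool) : Set (Fin (n + 2) → ℝ) :=
  slab n w a ∩ (fun x => x 1) ⁻¹' halfLine c

theorem measurableSet_halfSlab (n : ℕ) (w a : ℝ) (c : Bool) :
    MeasurableSet (halfSlab n w a c) := by
  refine (measurableSet_slab n w a).inter ((measurable_pi_apply 1) ?_)
  cases c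
  · exact measurableSet_Iio
  · exact measurableSet_Ici

/-- The translations that combine to a translation by `-s` of the first coordinate. -/
noncomputable def zigzag (n : ℕ) (Δ s : ℝ) (c : Bool) : Fin (n + 2) → ℝ :=
  planeVec n (-(s / 2)) (if c then s / Δ else -(s / Δ)) 0

/-- The instances among which no algorithm can tell the right one apart quickly. -/
noncomputable def hardInstance (n : ℕ) (Δ : ℝ) (c : Bool) : Fin (n + 2) → ℝ :=
  planeVec n 1 (if c then Δ / 2 else -(Δ / 2)) 1

theorem zigzag_dotProduct_hardInstance {Δ : ℝ} (hΔ : 0 < Δ) (n : ℕ) (s : ℝ) (c : Bool) :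
    zigzag n Δ s c ⬝ᵥ hardInstance n Δ c = 0 := by
  rw [zigzag, hardInstance, planeVec_zero_dotProduct]
  cases c <;> simp <;> field_simp <;> ring

/-- The top half slabs of width `1 / (m + 1)`, moved down in steps of length
`1 / ((m + 1) * N)`, each paired with a translation. -/
noncomputable def firstTests (n : ℕ) (Δ : ℝ) (N : ℕ) (k : (ℕ × ℕ) × Bool) :
    Set (Fin (n + 2) → ℝ) × (Fin (n + 2) → ℝ) :=
  (halfSlab n (1 / (k.1.1 + 1)) (1 - k.1.2 * (1 / ((k.1.1 + 1) * N))) k.2,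
    zigzag n Δ (1 / ((k.1.1 + 1) * N)) (!k.2))

/-- The translated sets of `firstTests`, each paired with the complementary translation. -/
noncomputable def secondTests (n : ℕ) (Δ : ℝ) (N : ℕ) (k : (ℕ × ℕ) × Bool) :
    Set (Fin (n + 2) → ℝ) × (Fin (n + 2) → ℝ) :=
  ((fun x => x - (firstTests n Δ N k).2) ⁻¹' (firstTests n Δ N k).1,
    zigzag n Δ (1 / ((k.1.1 + 1) * N)) k.2)

/-- The pairs of sets and translations that are used to compare slabs. -/
def slabTests (n : ℕ) (Δ : ℝ) (N : ℕ) : Set (Set (Fin (n + 2) → ℝ) × (Fin (n + 2) → ℝ)) :=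
  range (firstTests n Δ N) ∪ range (secondTests n Δ N)

theorem countable_slabTests (n : ℕ) (Δ : ℝ) (N : ℕ) : (slabTests n Δ N).Countable :=
  (countable_range _).union (countable_range _)

theorem measurableSet_of_mem_slabTests {n : ℕ} {Δ : ℝ} {N : ℕ}
    {p : Set (Fin (n + 2) → ℝ) × (Fin (n + 2) → ℝ)} (hp : p ∈ slabTests n Δ N) :
    MeasurableSet p.1 := by
  obtain ⟨k, rfl⟩ | ⟨k, rfl⟩ := hp
  · exact measurableSet_halfSlab _ _ _ _
  · exact (measurable_sub_const _) (measurableSet_halfSlab _ _ _ _)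

section

variable {n : ℕ} {Δ : ℝ} {N : ℕ} {π : Measure (Fin (n + 2) → ℝ)}

/-- The reason for halving slabs: the first move shifts the second coordinate by `s / Δ ≤ 1` towards
the opposite side, so it cannot leave `[-1,1]`. -/
theorem sub_zigzag_mem_choiceSet {s w a : ℝ} (hΔ : 0 < Δ) (hs0 : 0 ≤ s) (hs : s ≤ Δ)
    (ha : -1 ≤ a - w - s) {c : Bool} {x : Fin (n + 2) → ℝ} (hx : x ∈ halfSlab n w a c) :
    x + zigzag n Δ s (!c) ∈ choiceSet (n + 2) := by
  obtain ⟨⟨hx1, hx2⟩, hx3⟩ := hx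
  rw [mem_choiceSet_add_two] at hx1 ⊢
  have h1 : s / Δ ≤ 1 := (div_le_one hΔ).2 hs
  have h2 : 0 ≤ s / Δ := by positivity
  obtain ⟨⟨h3, h4⟩, ⟨h5, h6⟩, h7⟩ := hx1
  simp only [zigzag, Pi.add_apply, planeVec_zero, planeVec_one, planeVec_succ_succ, add_zero]
  refine ⟨⟨by linarith [hx2.1], by linarith⟩, ?_, h7⟩
  cases c
  · have : x 1 < 0 := hx3
    simp only [Bool.not_false, if_true]
    exact ⟨by linarith, by linarith⟩
  · have : 0 ≤ x 1 := hx3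
    simp only [Bool.not_true, if_false, Bool.false_eq_true]
    exact ⟨by linarith, by linarith⟩

theorem mem_halfSlab_of_sub_zigzag {s w a : ℝ} (hs0 : 0 ≤ s) (ha : -1 ≤ a - w - s) {c : Bool}
    {x : Fin (n + 2) → ℝ} (hx : x - zigzag n Δ s c - zigzag n Δ s (!c) ∈ halfSlab n w a c) :
    x ∈ halfSlab n w (a - s) c := by
  have h0 : (x - zigzag n Δ s c - zigzag n Δ s (!c)) 0 = x 0 + s := by
    simp only [zigzag, Pi.sub_apply, planeVec_zero]; ring
  have h1 : (x - zigzag n Δ s c - zigzag n Δ s (!c)) 1 = x 1 := by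
    simp only [zigzag, Pi.sub_apply, planeVec_one]; cases c <;> simp
  have h2 : ∀ i : Fin n, (x - zigzag n Δ s c - zigzag n Δ s (!c)) i.succ.succ = x i.succ.succ :=
    fun i => by simp [zigzag]
  obtain ⟨⟨hx1, hx2⟩, hx3⟩ := hx
  rw [mem_choiceSet_add_two, h0, h1] at hx1
  simp only [h2] at hx1
  rw [h0] at hx2
  rw [mem_preimage, h1] at hx3
  exact ⟨⟨mem_choiceSet_add_two.2 ⟨⟨by linarith [hx2.1], by linarith [hx1.1.2]⟩, hx1.2⟩,
    by linarith [hx2.1], by linarith [hx2.2]⟩, hx3⟩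

/-- Two neutral moves: fairness for the instance `!c` carries the half slab across, fairness for `c`
carries it back, and the net effect is one step down. -/
theorem measure_halfSlab_le_succ (hΔ : 0 < Δ) (hN : 1 / Δ ≤ N)
    (h : ∀ c, TranslationFair (slabTests n Δ N) (hardInstance n Δ c) π) {m i : ℕ}
    (hi : i + 1 ≤ (m + 1) * N) (c : Bool) :
    π (halfSlab n (1 / (m + 1)) (1 - i * (1 / ((m + 1) * N))) c) ≤
      π (halfSlab n (1 / (m + 1)) (1 - (i + 1 : ℕ) * (1 / ((m + 1) * N))) c) := by
  have hN0 : (0 : ℝ) < N := (by positivity : (0 : ℝ) < 1 / Δ).trans_le hN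
  have hm : (0 : ℝ) < m + 1 := by positivity
  have hw : 1 / ((m : ℝ) + 1) ≤ 1 := by rw [div_le_one hm]; simp
  have hi' : ((i : ℝ) + 1) * (1 / ((m + 1) * N)) ≤ 1 := by
    rw [mul_one_div, div_le_one (by positivity)]
    exact_mod_cast hi
  have hsΔ : 1 / (((m : ℝ) + 1) * N) ≤ Δ := by
    rw [div_le_iff₀ (by positivity)]
    rw [div_le_iff₀ hΔ] at hN
    nlinarith [mul_nonneg (mul_nonneg (Nat.cast_nonneg (α := ℝ) m) hN0.le) hΔ.le]
  have hs0 : 0 ≤ 1 / (((m : ℝ) + 1) * N) := by positivity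
  have ha : -1 ≤ 1 - i * (1 / (((m : ℝ) + 1) * N)) - 1 / (m + 1) - 1 / ((m + 1) * N) := by
    linarith
  have hstep : 1 - ((i + 1 : ℕ) : ℝ) * (1 / ((m + 1) * N)) =
      1 - i * (1 / (((m : ℝ) + 1) * N)) - 1 / ((m + 1) * N) := by push_cast; ring
  rw [hstep]
  have hfirst := h (!c) (firstTests n Δ N ((m, i), c)) ⟨Or.inl (mem_range_self _),
    fun x hx => hx.1.1, fun x hx => sub_zigzag_mem_choiceSet hΔ hs0 hsΔ ha hx,
    (zigzag_dotProduct_hardInstance hΔ _ _ _).ge⟩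
  have hsub : (fun x => x - (secondTests n Δ N ((m, i), c)).2) ⁻¹'
      (secondTests n Δ N ((m, i), c)).1 ⊆ halfSlab n (1 / (m + 1))
        (1 - i * (1 / (((m : ℝ) + 1) * N)) - 1 / ((m + 1) * N)) c :=
    fun x hx => mem_halfSlab_of_sub_zigzag hs0 ha hx
  have hsecond := h c (secondTests n Δ N ((m, i), c)) ⟨Or.inr (mem_range_self _),
    fun x hx => by simpa [firstTests] using sub_zigzag_mem_choiceSet hΔ hs0 hsΔ ha hx,
    fun x hx => (hsub (by simpa using hx)).1.1,
    (zigzag_dotProduct_hardInstance hΔ _ _ _).ge⟩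
  exact hfirst.trans (hsecond.trans (measure_mono hsub))

theorem measure_slab_eq_add (w a : ℝ) :
    π (slab n w a) = π (halfSlab n w a true) + π (halfSlab n w a false) := by
  rw [← measure_inter_add_sdiff (slab n w a)
    ((measurable_pi_apply 1) (measurableSet_Ici (a := (0 : ℝ))))]
  congr 2
  ext x
  simp [halfSlab, halfLine]

theorem measure_slab_one_le (hΔ : 0 < Δ) (hN : 1 / Δ ≤ N)
    (h : ∀ c, TranslationFair (slabTests n Δ N) (hardInstance n Δ c) π) (m : ℕ) {i : ℕ}
    (hi : i ≤ (m + 1) * N) :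
    π (slab n (1 / (m + 1)) 1) ≤ π (slab n (1 / (m + 1)) (1 - i * (1 / ((m + 1) * N)))) := by
  induction i with
  | zero => simp
  | succ i ih =>
    refine (ih (by omega)).trans ?_
    rw [measure_slab_eq_add, measure_slab_eq_add]
    exact add_le_add (measure_halfSlab_le_succ hΔ hN h hi _)
      (measure_halfSlab_le_succ hΔ hN h hi _)

/-- Every `N` steps move the slab by its own width, which yields `m + 1` disjoint slabs, each at
least as heavy as the top one. -/
theorem measure_slab_one_le_inv [IsProbabilityMeasure π] (hΔ : 0 < Δ) (hN : 1 / Δ ≤ N)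
    (h : ∀ c, TranslationFair (slabTests n Δ N) (hardInstance n Δ c) π) (m : ℕ) :
    π (slab n (1 / (m + 1)) 1) ≤ ((m + 1 : ℕ) : ℝ≥0∞)⁻¹ := by
  have hN0 : (0 : ℝ) < N := (by positivity : (0 : ℝ) < 1 / Δ).trans_le hN
  have hm : (0 : ℝ) < m + 1 := by positivity
  have hle : ∀ j ∈ Finset.range (m + 1),
      π (slab n (1 / (m + 1)) 1) ≤ π (slab n (1 / (m + 1)) (1 - j * (1 / (m + 1)))) :=
    fun j hj => by
      have := measure_slab_one_le hΔ hN h m (i := j * N)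
        (Nat.mul_le_mul_right _ (Finset.mem_range.1 hj).le)
      have heq : ((j * N : ℕ) : ℝ) * (1 / ((m + 1) * N)) = j * (1 / (m + 1)) := by
        push_cast; field_simp
      rwa [heq] at this
  have hdisj : Set.PairwiseDisjoint (Finset.range (m + 1) : Set ℕ)
      fun j : ℕ => slab n (1 / (m + 1)) (1 - j * (1 / (m + 1))) := by
    have key : ∀ j k : ℕ, j < k → Disjoint (slab n (1 / (m + 1)) (1 - j * (1 / (m + 1))))
        (slab n (1 / (m + 1)) (1 - k * (1 / (m + 1)))) := fun j k hjk => by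
      refine Set.disjoint_left.2 fun x hx hx' => ?_
      have h1 := hx.2.1
      have h2 := hx'.2.2
      have h3 : ((j : ℝ) + 1) * (1 / (m + 1)) ≤ k * (1 / (m + 1)) := by
        gcongr
        exact_mod_cast hjk
      linarith
    intro j _ k _ hjk
    rcases lt_or_gt_of_ne hjk with h | h
    · exact key j k h
    · exact (key k j h).symm
  rw [← one_div, ENNReal.le_div_iff_mul_le (by simp) (by simp), mul_comm, ← nsmul_eq_mul]
  have hsum := Finset.card_nsmul_le_sum _ _ _ hle
  rw [Finset.card_range, ← measure_biUnion_finset hdisj fun _ _ => measurableSet_slab _ _ _] at hsum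
  exact hsum.trans prob_le_one

/-- A distribution that is fair for both hard instances rarely picks a first coordinate close
to `1`. -/
theorem measure_one_sub_lt_le [IsProbabilityMeasure π] (hπ : π (choiceSet (n + 2))ᶜ = 0)
    (hΔ : 0 < Δ) (hN : 1 / Δ ≤ N)
    (h : ∀ c, TranslationFair (slabTests n Δ N) (hardInstance n Δ c) π) {u : ℝ} (hu : 0 < u) :
    π {x | max 0 (1 - x 0) < u} ≤ ENNReal.ofReal (2 * u) := by
  rcases le_or_gt 1 u with h1 | h1
  · refine prob_le_one.trans ?_
    rw [← ENNReal.ofReal_one]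
    exact ENNReal.ofReal_le_ofReal (by linarith)
  -- This choice gives `u ≤ 1 / (m + 1) ≤ 2 * u`: the slab covers the event, and rounding costs at
  -- most a factor 2.
  obtain ⟨m, hm⟩ : ∃ m, ⌊1 / u⌋₊ = m + 1 := Nat.exists_eq_succ_of_ne_zero
    (Nat.floor_pos.2 ((one_le_div hu).2 h1.le)).ne'
  have hm0 : (0 : ℝ) < (m + 1 : ℕ) := by positivity
  have h2 : ((m + 1 : ℕ) : ℝ) ≤ 1 / u := hm ▸ Nat.floor_le (by positivity)
  have h3 : 1 / u < ((m + 1 : ℕ) : ℝ) + 1 := hm ▸ Nat.lt_floor_add_one _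
  have h4 : (1 : ℝ) ≤ (m + 1 : ℕ) := by simp
  rw [← measure_inter_conull hπ]
  refine (measure_mono (t := slab n (1 / (m + 1)) 1) ?_).trans
    ((measure_slab_one_le_inv hΔ hN h m).trans ?_)
  · rintro x ⟨hx, hxC⟩
    have h5 : 1 - x 0 < u := (le_max_right _ _).trans_lt hx
    have h6 : u ≤ 1 / (m + 1) := by
      rw [le_div_iff₀ (by positivity)]
      rw [le_div_iff₀ hu] at h2
      push_cast at h2
      linarith
    exact ⟨hxC, by linarith, (mem_choiceSet.1 hxC 0).2⟩
  · rw [← ENNReal.ofReal_natCast, ← ENNReal.ofReal_inv_of_pos hm0]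
    refine ENNReal.ofReal_le_ofReal ?_
    rw [inv_le_iff_one_le_mul₀ hm0]
    rw [div_lt_iff₀ hu] at h3
    nlinarith

end

/-! ### Regret and gap -/

theorem dotProduct_le_optValue {d : ℕ} (β : Fin d → ℝ) {x : Fin d → ℝ} (hx : x ∈ choiceSet d) :
    x ⬝ᵥ β ≤ optValue β := by
  refine le_csSup ?_ (mem_image_of_mem _ hx)
  exact (isCompact_Icc.image (by simp only [dotProduct]; fun_prop)).bddAbove

theorem update_mem_choiceSet {d : ℕ} {x : Fin d → ℝ} (hx : x ∈ choiceSet d) (i : Fin d) {a : ℝ}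
    (ha : a ∈ Icc (-1 : ℝ) 1) : Function.update x i a ∈ choiceSet d := by
  rw [mem_choiceSet] at hx ⊢
  intro j
  by_cases hj : j = i
  · subst hj; simpa using ha
  · simpa [hj] using hx j

theorem update_dotProduct {d : ℕ} (x β : Fin d → ℝ) (i : Fin d) (a : ℝ) :
    Function.update x i a ⬝ᵥ β = x ⬝ᵥ β + (a - x i) * β i := by
  have : Function.update x i a = x + Pi.single i (a - x i) := by
    funext j
    by_cases hj : j = i
    · subst hj; simp
    · simp [hj]
  rw [this, add_dotProduct, single_dotProduct]

/-- Raising the first coordinate of a choice to 1 stays in the cube and gains `1 - x 0`. The maximum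
with 0 only makes the cost nonnegative outside the cube. -/
theorem cost_le_regret {n T : ℕ} {β : Fin (n + 2) → ℝ} (hβ : β 0 = 1) {h : History (n + 2) T}
    (hh : ∀ i, (h i).1 ∈ choiceSet (n + 2)) :
    cost (fun x => max 0 (1 - x 0)) h ≤ regret β h := by
  refine Finset.sum_le_sum fun i _ => max_le ?_ ?_
  · linarith [dotProduct_le_optValue β (hh i)]
  · have := dotProduct_le_optValue β
      (update_mem_choiceSet (hh i) 0 (a := 1) (right_mem_Icc.2 (by norm_num)))
    rw [update_dotProduct, hβ] at this
    linarith

theorem mem_extremePoints_Icc_iff {x : ℝ} :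
    x ∈ extremePoints ℝ (Icc (-1 : ℝ) 1) ↔ x = -1 ∨ x = 1 := by
  rw [mem_extremePoints]
  constructor
  · rintro ⟨⟨h1, h2⟩, h⟩
    by_contra! hne
    have hx : x ∈ openSegment ℝ (-1 : ℝ) 1 := by
      rw [openSegment_eq_Ioo (by norm_num)]
      exact ⟨lt_of_le_of_ne h1 hne.1.symm, lt_of_le_of_ne h2 hne.2⟩
    exact hne.1 (h (-1) (by simp) 1 (by simp) hx).1.symm
  · have key : ∀ a b y z : ℝ, 0 < a → 0 < b → a + b = 1 → y ≤ 1 → z ≤ 1 → a * y + b * z = 1 →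
        y = 1 ∧ z = 1 := fun a b y z ha hb hab hy hz h => by
      constructor <;> nlinarith [mul_nonneg ha.le (sub_nonneg.2 hy),
        mul_nonneg hb.le (sub_nonneg.2 hz)]
    rintro (rfl | rfl)
    · refine ⟨by simp, ?_⟩
      rintro y hy z hz ⟨a, b, ha, hb, hab, h⟩
      obtain ⟨h1, h2⟩ := key a b (-y) (-z) ha hb hab (by linarith [hy.1]) (by linarith [hz.1])
        (by simp only [smul_eq_mul] at h; linarith)
      exact ⟨by linarith, by linarith⟩
    · refine ⟨by simp, ?_⟩
      rintro y hy z hz ⟨a, b, ha, hb, hab, h⟩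
      exact key a b y z ha hb hab hy.2 hz.2 h

theorem mem_extremePoints_choiceSet_iff {d : ℕ} {x : Fin d → ℝ} :
    x ∈ extremePoints ℝ (choiceSet d) ↔ ∀ i, x i = -1 ∨ x i = 1 := by
  rw [choiceSet, ← pi_univ_Icc, extremePoints_pi]
  simp only [mem_univ_pi, mem_extremePoints_Icc_iff]

/-- A maximizer attains `|β i|` in every coordinate, so no coordinate of a vertex can gain, and one
that differs loses `2 * |β j| ≥ Δ`. -/
theorem le_gap {d : ℕ} [NeZero d] {β : Fin d → ℝ} {Δ : ℝ} (hΔ : 0 < Δ)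
    (hβ : ∀ i, Δ / 2 ≤ |β i|) : Δ ≤ gap β := by
  refine le_csInf ?_ ?_
  -- The infimum of the empty set would be 0, so a competitor is exhibited: the sign vector `s` is
  -- optimal and `-s` is another vertex.
  · have hsgn : ∀ i, ∃ s : ℝ, (s = -1 ∨ s = 1) ∧ s * β i = |β i| := fun i => by
      rcases le_total 0 (β i) with h | h
      · exact ⟨1, by simp, by rw [abs_of_nonneg h, one_mul]⟩
      · exact ⟨-1, by simp, by rw [abs_of_nonpos h, neg_one_mul]⟩
    choose s hs hsβ using hsgn
    refine ⟨_, s, ?_, ?_, -s, ?_, ?_, rfl⟩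
    · exact mem_choiceSet.2 fun i => by rcases hs i with h | h <;> simp [h]
    · intro y hy
      refine Finset.sum_le_sum fun i _ => ?_
      rw [hsβ]
      refine (le_abs_self _).trans ?_
      rw [abs_mul]
      exact mul_le_of_le_one_left (abs_nonneg _) (abs_le.2 (mem_choiceSet.1 hy i))
    · exact mem_extremePoints_choiceSet_iff.2 fun i => by rcases hs i with h | h <;> simp [h]
    · intro h
      have := congrFun h 0
      rcases hs 0 with h | h <;> norm_num [h] at this
  · rintro r ⟨xs, hxs, hmax, x, hx, hne, rfl⟩
    have hC := mem_choiceSet.1 hxs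
    have hopt : ∀ i, |β i| ≤ xs i * β i := fun i => by
      have h1 := hmax _ (update_mem_choiceSet hxs i (a := 1) (by simp))
      have h2 := hmax _ (update_mem_choiceSet hxs i (a := -1) (by simp))
      rw [update_dotProduct] at h1 h2
      exact abs_le.2 ⟨by linarith, by linarith⟩
    rw [mem_extremePoints_choiceSet_iff] at hx
    have hterm : ∀ i, 0 ≤ (xs - x) i * β i := fun i => by
      rw [Pi.sub_apply, sub_mul]
      have := abs_le.1 (le_refl |β i|)
      rcases hx i with h | h <;> rw [h] <;> linarith [hopt i]
    obtain ⟨j, hj⟩ := Function.ne_iff.1 hne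
    have hjterm : Δ ≤ (xs - x) j * β j := by
      have hβj := hβ j
      have := hopt j
      rw [Pi.sub_apply, sub_mul]
      rcases lt_trichotomy (β j) 0 with h0 | h0 | h0
      · rw [abs_of_neg h0] at *
        have hxj : xs j = -1 := le_antisymm (by nlinarith) (hC j).1
        rcases hx j with h | h
        · exact absurd (h.trans hxj.symm) hj
        · rw [h, hxj]; linarith
      · rw [h0, abs_zero] at hβj; linarith
      · rw [abs_of_pos h0] at *
        have hxj : xs j = 1 := le_antisymm (hC j).2 (by nlinarith)
        rcases hx j with h | h
        · rw [h, hxj]; linarith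
        · exact absurd (h.trans hxj.symm) hj
    exact hjterm.trans (Finset.single_le_sum (f := fun i => (xs - x) i * β i)
      (fun i _ => hterm i) (Finset.mem_univ j))

/-! ### The hard instances -/

theorem hardInstance_mem_choiceSet (n : ℕ) {Δ : ℝ} (hΔ : 0 < Δ) (hΔ2 : Δ ≤ 2) (c : Bool) :
    hardInstance n Δ c ∈ choiceSet (n + 2) := by
  rw [mem_choiceSet_add_two]
  simp only [hardInstance, planeVec_zero, planeVec_one, planeVec_succ_succ]
  refine ⟨by simp, ?_, by simp⟩
  cases c <;> simp only [Bool.false_eq_true, if_true, if_false] <;> constructor <;> linarith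

theorem le_gap_hardInstance (n : ℕ) {Δ : ℝ} (hΔ : 0 < Δ) (hΔ2 : Δ ≤ 2) (c : Bool) :
    Δ ≤ gap (hardInstance n Δ c) := by
  refine le_gap hΔ ?_
  simp only [Fin.forall_fin_succ]
  refine ⟨?_, ?_, fun i => ?_⟩
  · change Δ / 2 ≤ |(1 : ℝ)|
    rw [abs_one]; linarith
  · change Δ / 2 ≤ |if c then Δ / 2 else -(Δ / 2)|
    cases c <;> simp [le_abs_self]
  · change Δ / 2 ≤ |(1 : ℝ)|
    rw [abs_one]; linarith

theorem abs_dotProduct_hardInstance_sub_le {n : ℕ} {Δ : ℝ} (hΔ : 0 < Δ) (c : Bool)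
    {x : Fin (n + 2) → ℝ} (hx : x ∈ choiceSet (n + 2)) :
    |x ⬝ᵥ hardInstance n Δ c - x ⬝ᵥ hardInstance n Δ (!c)| ≤ Δ := by
  have h1 := mem_choiceSet.1 hx 1
  have h2 : x ⬝ᵥ hardInstance n Δ c - x ⬝ᵥ hardInstance n Δ (!c) =
      if c then x 1 * Δ else -(x 1 * Δ) := by
    cases c <;> simp [dotProduct, Fin.sum_univ_succ, hardInstance, planeVec] <;> ring
  have h3 : |x 1 * Δ| ≤ Δ := by
    rw [abs_mul, abs_of_pos hΔ]
    exact mul_le_of_le_one_left hΔ.le (abs_le.2 h1)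
  rw [h2]
  cases c <;> simpa using h3

/-- The fairness event need not be measurable, so complements are taken only after enlarging it to
the measurable `always M T`. -/
theorem historyKernel_compl_always_le {d T : ℕ} {A : ℝ → Algorithm d} (hA : IsFair A T)
    {δ : ℝ} (hδ : 0 < δ) (hδ1 : δ ≤ 1) {β : Fin d → ℝ} (hβ : β ∈ choiceSet d)
    {M : ∀ t, Set (History d t)} (hM : ∀ t, MeasurableSet (M t))
    (h : ∀ t h, RoundFair β ((A δ).policy t h) → h ∈ M t) :
    (A δ).historyKernel T β (always M T)ᶜ ≤ ENNReal.ofReal δ := by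
  rw [prob_compl_eq_one_sub (measurableSet_always hM T)]
  have h1 : ENNReal.ofReal (1 - δ) ≤ (A δ).historyKernel T β (always M T) :=
    (hA δ hδ hδ1 β hβ).trans (measure_mono fun h' hh' => mem_always.2 fun i => h _ _ (hh' i))
  refine (tsub_le_tsub_left h1 _).trans ?_
  rw [← ENNReal.ofReal_one, ← ENNReal.ofReal_sub _ (by linarith), sub_sub_cancel]

theorem le_historyKernel_le_regret {n T : ℕ} {Δ : ℝ} (hΔ : 0 < Δ) (hΔ2 : Δ ≤ 2)
    (hT : 1 / Δ ≤ (T : ℝ)) {A : ℝ → Algorithm (n + 2)} (hA : IsFair A T) {δ δ' : ℝ} (hδ : 0 < δ)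
    (hδ1 : δ < 1) (hδ' : 0 < δ') (hδδ' : δ' ≤ δ / 8) (c : Bool) :
    ENNReal.ofReal (1 - δ) ≤ (A δ').historyKernel T (hardInstance n Δ c)
      {h | 1 / 32 * δ / Δ ≤ regret (hardInstance n Δ c) h} := by
  obtain ⟨N, hN⟩ := exists_nat_ge (1 / Δ)
  have hT0 : (0 : ℝ) < T := (by positivity : (0 : ℝ) < 1 / Δ).trans_le hT
  set r := 1 / 32 * δ / Δ with hr
  have hr0 : 0 < r := by positivity
  set ρ : (Fin (n + 2) → ℝ) → ℝ := fun x => max 0 (1 - x 0) with hρ_def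
  have hρ : Measurable ρ := by fun_prop
  let M : Bool → ∀ t, Set (History (n + 2) t) := fun b t =>
    {h | TranslationFair (slabTests n Δ N) (hardInstance n Δ b) ((A δ').policy t h)}
  have hM : ∀ b t, MeasurableSet (M b t) := fun b t =>
    measurableSet_translationFair (fun _ => measurableSet_of_mem_slabTests)
      (countable_slabTests n Δ N) _ _
  have hfair : ∀ b, (A δ').historyKernel T (hardInstance n Δ b) (always (M b) T)ᶜ ≤
      ENNReal.ofReal δ' := fun b =>
    historyKernel_compl_always_le hA hδ' (by linarith) (hardInstance_mem_choiceSet n hΔ hΔ2 b)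
      (hM b) fun t h hh => hh.translationFair fun _ => measurableSet_of_mem_slabTests
  have hcost := historyKernel_cost_lt_le (A δ') (hM c) (hM !c) hρ (fun x => le_max_left _ _)
    (fun t h hh u hu => measure_one_sub_lt_le ((A δ').support t h) hΔ hN
      (fun b => by cases b <;> cases c <;> first | exact hh.1 | exact hh.2) hu)
    (fun x hx => abs_dotProduct_hardInstance_sub_le hΔ c hx) r (Nat.cast_pos.1 hT0)
  have hbound : (A δ').historyKernel T (hardInstance n Δ c) {h | cost ρ h < r} ≤
      ENNReal.ofReal δ := by
    refine hcost.trans ((add_le_add_left (add_le_add_left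
      (add_le_add (hfair c) (hfair !c)) _) _).trans ?_)
    rw [← ENNReal.ofReal_natCast, ← ENNReal.ofReal_div_of_pos hT0, ← ENNReal.ofReal_mul hΔ.le,
      ← ENNReal.ofReal_add hδ'.le hδ'.le, ← ENNReal.ofReal_add (by positivity) (by positivity),
      ← ENNReal.ofReal_add (by positivity) (by positivity)]
    refine ENNReal.ofReal_le_ofReal ?_
    -- The constant `1/32` makes this term `δ / 4`; `T ≥ 1 / Δ` bounds the survival term likewise,
    -- and `2 * δ' ≤ δ / 4`.
    have h1 : Δ * (8 * r) = δ / 4 := by rw [hr]; field_simp; norm_num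
    have h2 : 8 * r / T ≤ δ / 4 := by
      rw [div_le_iff₀ hT0, ← h1]
      rw [div_le_iff₀ hΔ] at hT
      nlinarith
    linarith
  have hmeas : MeasurableSet {h : History (n + 2) T | cost ρ h < r} :=
    measurableSet_lt (measurable_cost hρ) measurable_const
  calc ENNReal.ofReal (1 - δ) = 1 - ENNReal.ofReal δ := by
        rw [ENNReal.ofReal_sub _ hδ.le, ENNReal.ofReal_one]
    _ ≤ 1 - (A δ').historyKernel T (hardInstance n Δ c) {h | cost ρ h < r} :=
      tsub_le_tsub_left hbound _
    _ = (A δ').historyKernel T (hardInstance n Δ c) {h | cost ρ h < r}ᶜ :=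
      (prob_compl_eq_one_sub hmeas).symm
    _ ≤ _ := by
      refine measure_mono_ae ?_
      filter_upwards [ae_mem_choiceSet (A δ') (hardInstance n Δ c) T] with h hh hlt
      exact (not_lt.1 (mem_compl_iff _ _ |>.1 hlt)).trans (cost_le_regret rfl hh)

/-- The uniform distribution on the two hard instances. -/
noncomputable def hardPrior (n : ℕ) (Δ : ℝ) : Measure (Fin (n + 2) → ℝ) :=
  (2⁻¹ : ℝ≥0∞) • (Measure.dirac (hardInstance n Δ true) + Measure.dirac (hardInstance n Δ false))

instance (n : ℕ) (Δ : ℝ) : IsProbabilityMeasure (hardPrior n Δ) :=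
  ⟨by simp [hardPrior, ENNReal.inv_two_add_inv_two]⟩

theorem lintegral_hardPrior (n : ℕ) (Δ : ℝ) (f : (Fin (n + 2) → ℝ) → ℝ≥0∞) :
    ∫⁻ β, f β ∂(hardPrior n Δ) =
      2⁻¹ * (f (hardInstance n Δ true) + f (hardInstance n Δ false)) := by
  rw [hardPrior, lintegral_smul_measure, lintegral_add_measure, lintegral_dirac, lintegral_dirac]
  rfl

theorem ae_hardPrior {n : ℕ} {Δ : ℝ} {p : (Fin (n + 2) → ℝ) → Prop}
    (h : ∀ c, p (hardInstance n Δ c)) : ∀ᵐ β ∂(hardPrior n Δ), p β := by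
  refine Measure.ae_smul_measure ?_ _
  rw [ae_add_measure_iff, ae_dirac_eq, ae_dirac_eq]
  exact ⟨h true, h false⟩

end FairBandit

theorem mainTheorem3 :
    ∃ c : ℝ, 0 < c ∧
      ∀ d : ℕ, 2 ≤ d → ∀ Δ : ℝ, 0 < Δ → Δ ≤ 2 →
        ∃ τ : Measure (Fin d → ℝ), IsProbabilityMeasure τ ∧
          (∀ᵐ β ∂τ, β ∈ FairBandit.choiceSet d ∧ Δ ≤ FairBandit.gap β) ∧
          ∀ (T : ℕ), 1 / Δ ≤ (T : ℝ) →
            ∀ A : ℝ → FairBandit.Algorithm d, FairBandit.IsFair A T →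
              ∀ δ δ' : ℝ, 0 < δ → δ < 1 → 0 < δ' → δ' ≤ δ / 8 →
                ENNReal.ofReal (1 - δ) ≤
                  (τ ⊗ₘ (A δ').historyKernel T)
                    {p | c * δ / Δ ≤ FairBandit.regret p.1 p.2} := by
  refine ⟨1 / 32, by norm_num, fun d hd Δ hΔ hΔ2 => ?_⟩
  obtain ⟨n, rfl⟩ := Nat.exists_eq_add_of_le' hd
  refine ⟨FairBandit.hardPrior n Δ, inferInstance, FairBandit.ae_hardPrior fun c =>
    ⟨FairBandit.hardInstance_mem_choiceSet n hΔ hΔ2 c, FairBandit.le_gap_hardInstance n hΔ hΔ2 c⟩,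
    fun T hT A hA δ δ' hδ hδ1 hδ' hδδ' => ?_⟩
  have key := FairBandit.le_historyKernel_le_regret hΔ hΔ2 hT hA hδ hδ1 hδ' hδδ'
  -- This inequality holds for arbitrary sets, so joint measurability of the regret in `β` and the
  -- history is not needed.
  refine le_trans ?_ (Kernel.le_compProd_apply _ _ _ _)
  change _ ≤ ∫⁻ β, (A δ').historyKernel T β {h | 1 / 32 * δ / Δ ≤ FairBandit.regret β h}
    ∂(FairBandit.hardPrior n Δ)
  rw [FairBandit.lintegral_hardPrior]
  calc ENNReal.ofReal (1 - δ) = 2⁻¹ * (ENNReal.ofReal (1 - δ) + ENNReal.ofReal (1 - δ)) := by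
        rw [← two_mul, ← mul_assoc, ENNReal.inv_mul_cancel (by simp) (by simp), one_mul]
    _ ≤ _ := by gcongr <;> exact key _
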